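/- Let $A$ and $B$ be unital $C^*$-algebras. A Hilbert $A$-$B$-module is a right Hilbert $B$-module $E$ (complex vector space, right $B$-module, $B$-valued inner product $\langle\cdot,\cdot\rangle$ linear in the second variable, complete in the norm $\|x\|=\|\langle x,x\rangle\|^{1/2}$) together with a unital representation of $A$ by adjointable operators on $E$. For a completely positive map $\varphi:A\to B$ put $S(E,\varphi)=\{x\in E:\varphi(a)=\langle x,ax\rangle\ \forall a\in A\}$. The Bures distance of completely positive maps $\varphi_1,\varphi_2:A\to B$ is $$\beta(\varphi_1,\varphi_2)=\inf_E\ \inf\{\|x_1-x_2\| : x_i\in S(E,\varphi_i),\ i=1,2\},$$ where $E$ runs over all Hilbert $A$-$B$-modules for which $S(E,\varphi_1)$ and $S(E,\varphi_2)$ are both non-empty. Write $\operatorname{Re} b=\tfrac12(b+b^*)$. Corollary 2.9. Let $A$ be a unital $C^*$-algebra and let $B\subseteq\mathcal B(G)$ be a von Neumann algebra. (i) If $\varphi_1,\varphi_2:A\to B$ are unital $*$-homomorphisms, then $$\beta(\varphi_1,\varphi_2)=\sqrt2\,\inf\{\|1-\operatorname{Re} b\|^{1/2} : b\in B,\ \|b\|\le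 1,\ \varphi_1(a)b=b\varphi_2(a)\ \forall a\in A\}.$$ (ii) If $\varphi_1,\varphi_2:B\to B$ are unital $*$-homomorphisms and $\varphi_2(a)=u^*\varphi_1(a)u$ for all $a\in B$, for some unitary $u\in B$, then $$\beta(\varphi_1,\varphi_2)=\sqrt2\,\inf\{\|1-\operatorname{Re}(b'u)\|^{1/2} : b'\in\varphi_1(B)',\ \|b'\|\le 1\},$$ where $\varphi_1(B)'=\{b'\in B : b'\varphi_1(a)=\varphi_1(a)b'\ \forall a\in B\}$ is the commutant of $\varphi_1(B)$ in $B$. (iii) If $u\in M_n(\mathbb C)$ is unitary and $\varphi:M_n(\mathbb C)\to M_n(\mathbb C)$ is the $*$-homomorphism $\varphi(a)=u^*au$, then $$\beta(\mathrm{id},\varphi)=\sqrt2\,\inf\{\|1-\operatorname{Re}(\lambda u)\|^{1/2} : \lambda\in\mathbb C,\ |\lambda|\le 1\}.$$ -/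

import Mathlib

open scoped ComplexStarModule Matrix.Norms.L2Operator

universe u v

/-- A von Neumann algebra is norm closed in `G →L[ℂ] G`, being equal to its double commutant. -/
instance VonNeumannAlgebra.instIsClosed {G : Type v} [NormedAddCommGroup G]
    [InnerProductSpace ℂ G] [CompleteSpace G] (B : VonNeumannAlgebra G) :
    IsClosed (B : Set (G →L[ℂ] G)) := by
  rw [← B.centralizer_centralizer]
  exact Set.isClosed_centralizer _

instance VonNeumannAlgebra.instSMulMemClass {G : Type v} [NormedAddCommGroup G]
    [InnerProductSpace ℂ G] [CompleteSpace G] :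
    SMulMemClass (VonNeumannAlgebra G) ℂ (G →L[ℂ] G) where
  smul_mem {B} c _ hx := B.toStarSubalgebra.smul_mem hx c

/-- The C⋆-algebra structure on (the underlying type of) a von Neumann algebra, with operations
and norm restricted from `G →L[ℂ] G`. -/
noncomputable instance VonNeumannAlgebra.instCStarAlgebra {G : Type v} [NormedAddCommGroup G]
    [InnerProductSpace ℂ G] [CompleteSpace G] (B : VonNeumannAlgebra G) : CStarAlgebra B :=
  StarSubalgebra.cstarAlgebra B

/-- A Hilbert `A`-`B`-module for unital C⋆-algebras `A` and `B`: a complex vector space `E` which is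
a right `B`-module (`x b` is written `MulOpposite.op b • x`) with a `B`-valued inner product, linear
in the second variable, complete for the norm `‖x‖ = ‖⟪x, x⟫‖ ^ (1 / 2)`, together with a unital
representation of `A` by adjointable operators on `E`.

Positivity in `B` is expressed as being of the form `b⋆ b`; definiteness of the inner product is
part of `norm_sq_eq`, since the norm is definite. The underlying type lives in a universe that is
large enough for the GNS-modules of all maps `A → B`. -/
structure HilbertBimodule (A : Type u) (B : Type v) [CStarAlgebra A] [CStarAlgebra B] where
  /-- The underlying type. -/
  carrier : Type (max u v)
  [normedAddCommGroup : NormedAddCommGroup carrier]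
  [normedSpace : NormedSpace ℂ carrier]
  [completeSpace : CompleteSpace carrier]
  [rightModule : Module Bᵐᵒᵖ carrier]
  /-- The `B`-valued inner product. -/
  inner : carrier → carrier → B
  inner_add_right : ∀ x y z, inner x (y + z) = inner x y + inner x z
  inner_smul_right : ∀ (c : ℂ) (x y), inner x (c • y) = c • inner x y
  inner_act_right : ∀ (b : B) (x y), inner x (MulOpposite.op b • y) = inner x y * b
  star_inner : ∀ x y, star (inner x y) = inner y x
  inner_self_nonneg : ∀ x, ∃ b : B, inner x x = star b * b
  norm_sq_eq : ∀ x, ‖x‖ ^ 2 = ‖inner x x‖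
  /-- The left action of `A`. -/
  left : A →ₐ[ℂ] Module.End ℂ carrier
  /-- The operator `left (star a)` is the adjoint of `left a`, i.e. `left` is a ⋆-homomorphism into
  the adjointable operators (which are automatically bounded and right `B`-linear). -/
  inner_left : ∀ (a : A) (x y), inner (left a x) y = inner x (left (star a) y)

attribute [instance] HilbertBimodule.normedAddCommGroup HilbertBimodule.normedSpace
  HilbertBimodule.completeSpace HilbertBimodule.rightModule

section Bures

variable {A : Type u} {B : Type v} [CStarAlgebra A] [CStarAlgebra B]

/-- The set `S(E, φ)` of all `x ∈ E` with `φ a = ⟪x, a x⟫` for all `a ∈ A`. -/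
def repSet (E : HilbertBimodule A B) (φ : A → B) : Set E.carrier :=
  {x | ∀ a, φ a = E.inner x (E.left a x)}

/-- `E` is a common representation module for `φ₁` and `φ₂`: both are represented in `E`. -/
def IsCommonRepModule (E : HilbertBimodule A B) (φ₁ φ₂ : A → B) : Prop :=
  (repSet E φ₁).Nonempty ∧ (repSet E φ₂).Nonempty

/-- `β_E(φ₁, φ₂)`, for a common representation module `E`. -/
noncomputable def buresOn (E : HilbertBimodule A B) (φ₁ φ₂ : A → B) : ℝ :=
  sInf {r | ∃ x₁ ∈ repSet E φ₁, ∃ x₂ ∈ repSet E φ₂, r = ‖x₁ - x₂‖}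

/-- The Bures distance `β(φ₁, φ₂)` of completely positive maps `φ₁, φ₂ : A → B`: the infimum of
`β_E(φ₁, φ₂)` over all common representation modules `E`. -/
noncomputable def buresDist (φ₁ φ₂ : A → B) : ℝ :=
  sInf {r | ∃ E : HilbertBimodule A B, IsCommonRepModule E φ₁ φ₂ ∧ r = buresOn E φ₁ φ₂}

end Bures

/-! ### Vectors representing unital ⋆-homomorphisms. -/

namespace HilbertBimodule

variable {A : Type u} {B : Type v} [CStarAlgebra A] [CStarAlgebra B] (E : HilbertBimodule A B)

/-! If `x₁`, `x₂` represent unital ⋆-homomorphisms `φ₁`, `φ₂`, then both have inner square `1` and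
`a xᵢ = xᵢ φᵢ(a)`. Hence `b = ⟪x₁, x₂⟫` is a contractive intertwiner (`intertwines_inner`,
`norm_inner_le_one`), and the distance depends on `b` alone: `‖x₁ - x₂‖² = 2‖1 - Re b‖`
(`norm_sub_eq`). Conversely, every contractive intertwiner `b` arises in this way in `B ⊕ B`, from
`(1, 0)` and `(b, √(1 - b⋆b))` (`exists_inner_eq_of_intertwines`). This gives (i) over any unital
C⋆-algebra. For (ii), `b ↦ b u⋆` carries intertwiners isometrically onto the commutant of the range
of `φ₁`; for (iii), that commutant is the scalars. -/

theorem inner_add_left (x y z : E.carrier) : E.inner (x + y) z = E.inner x z + E.inner y z := by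
  rw [← E.star_inner, E.inner_add_right, star_add, E.star_inner, E.star_inner]

theorem inner_sub_right (x y z : E.carrier) : E.inner x (y - z) = E.inner x y - E.inner x z := by
  rw [eq_sub_iff_add_eq, ← E.inner_add_right, sub_add_cancel]

theorem inner_sub_left (x y z : E.carrier) : E.inner (x - y) z = E.inner x z - E.inner y z := by
  rw [eq_sub_iff_add_eq, ← E.inner_add_left, sub_add_cancel]

theorem inner_act_left (b : B) (x y : E.carrier) :
    E.inner (MulOpposite.op b • x) y = star b * E.inner x y := by
  rw [← E.star_inner, E.inner_act_right, star_mul, E.star_inner]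

theorem eq_zero_of_inner_self {x : E.carrier} (h : E.inner x x = 0) : x = 0 := by
  have := E.norm_sq_eq x
  rw [h, norm_zero] at this
  simpa using this

variable {E}

theorem inner_self_of_mem_repSet {φ : A →⋆ₐ[ℂ] B} {x : E.carrier} (hx : x ∈ repSet E φ) :
    E.inner x x = 1 := by
  simpa using (hx 1).symm

/-- A vector representing a unital ⋆-homomorphism intertwines the left and the right action. -/
theorem left_eq_act_of_mem_repSet {φ : A →⋆ₐ[ℂ] B} {x : E.carrier} (hx : x ∈ repSet E φ) (a : A) :
    E.left a x = MulOpposite.op (φ a) • x := by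
  have h : ∀ c : A, E.inner x (E.left c x) = φ c := fun c ↦ (hx c).symm
  have h1 := inner_self_of_mem_repSet hx
  rw [← sub_eq_zero]
  apply E.eq_zero_of_inner_self
  have h2 : E.inner (E.left a x) (E.left a x) = star (φ a) * φ a := by
    rw [E.inner_left, ← Module.End.mul_apply, ← map_mul, h, map_mul, map_star]
  have h3 : E.inner (E.left a x) x = star (φ a) := by rw [E.inner_left, h, map_star]
  -- All four terms in the inner square of `a x - x φ(a)` are `± φ(a)⋆ φ(a)`; multiplicativity of
  -- `φ` enters through `h2`.
  simp only [inner_sub_left, inner_sub_right, inner_act_left, E.inner_act_right, h2, h3, h, h1]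
  simp

theorem intertwines_inner {φ₁ φ₂ : A →⋆ₐ[ℂ] B} {x₁ x₂ : E.carrier} (h₁ : x₁ ∈ repSet E φ₁)
    (h₂ : x₂ ∈ repSet E φ₂) (a : A) : φ₁ a * E.inner x₁ x₂ = E.inner x₁ x₂ * φ₂ a := by
  rw [← E.inner_act_right, ← left_eq_act_of_mem_repSet h₂, ← star_star a, ← E.inner_left,
    left_eq_act_of_mem_repSet h₁, inner_act_left, map_star]

/-- Cauchy–Schwarz: with `b = ⟪x, y⟫`, the component `y - x b` of `y` orthogonal to `x` has inner
square `1 - b⋆b`, so `b⋆b ≤ 1`. -/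
theorem norm_inner_le_one {x y : E.carrier} (hx : E.inner x x = 1) (hy : E.inner y y = 1) :
    ‖E.inner x y‖ ≤ 1 := by
  let _ := CStarAlgebra.spectralOrder B
  have _ := CStarAlgebra.spectralOrderedRing B
  obtain ⟨c, hc⟩ := E.inner_self_nonneg (y - MulOpposite.op (E.inner x y) • x)
  have key : star c * c = 1 - star (E.inner x y) * E.inner x y := by
    rw [← hc]
    simp only [inner_sub_left, inner_sub_right, inner_act_left, E.inner_act_right, hx, hy,
      E.star_inner]
    simp
  have hle : star (E.inner x y) * E.inner x y ≤ 1 := by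
    rw [← sub_nonneg, ← key]; exact star_mul_self_nonneg c
  have := (CStarAlgebra.norm_le_one_iff_of_nonneg _ (star_mul_self_nonneg (E.inner x y))).2 hle
  rw [CStarRing.norm_star_mul_self] at this
  nlinarith [norm_nonneg (E.inner x y)]

theorem norm_sub_eq {x y : E.carrier} (hx : E.inner x x = 1) (hy : E.inner y y = 1) :
    ‖x - y‖ = √2 * √‖1 - (ℜ (E.inner x y) : B)‖ := by
  rw [← Real.sqrt_mul zero_le_two, eq_comm, Real.sqrt_eq_iff_mul_self_eq (by positivity)
    (norm_nonneg _), ← sq, E.norm_sq_eq]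
  have : E.inner (x - y) (x - y) = (2 : ℝ) • (1 - (ℜ (E.inner x y) : B)) := by
    rw [realPart_apply_coe, smul_sub, smul_inv_smul₀ two_ne_zero, two_smul]
    simp only [inner_sub_left, inner_sub_right, hx, hy, E.star_inner]
    abel
  rw [this, norm_smul]
  simp

end HilbertBimodule

/-! ### Realizing contractive intertwiners in `B ⊕ B`. -/

section DirectSum

variable {A : Type u} {B : Type v} [CStarAlgebra A] [CStarAlgebra B]

open WithCStarModule MulOpposite

attribute [local instance] CStarAlgebra.spectralOrder CStarAlgebra.spectralOrderedRing

/-- The right Hilbert `B`-module `B ⊕ B`, written as a left C⋆-module over `Bᵐᵒᵖ`. -/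
abbrev HilbertPair (B : Type v) [CStarAlgebra B] : Type v :=
  WithCStarModule Bᵐᵒᵖ (Bᵐᵒᵖ × Bᵐᵒᵖ)

/-- The element `(y, z)` of `B ⊕ B`. -/
def HilbertPair.mk (y z : B) : HilbertPair B := (equiv _ _).symm (op y, op z)

theorem HilbertPair.inner_eq (x y : HilbertPair B) : unop (Inner.inner Bᵐᵒᵖ x y) =
    star (unop x.1) * unop y.1 + star (unop x.2) * unop y.2 := rfl

/-- The Hilbert `A`-`B`-module `B ⊕ B`, with `A` acting by left multiplication through `φ₁` on the
first and through `φ₂` on the second summand. -/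
noncomputable def HilbertBimodule.ofPair (φ₁ φ₂ : A →⋆ₐ[ℂ] B) : HilbertBimodule A B where
  carrier := ULift.{max u v} (HilbertPair B)
  inner x y := unop (Inner.inner Bᵐᵒᵖ x.down y.down)
  inner_add_right x y z := by simp
  inner_smul_right c x y := by simp
  inner_act_right b x y := by simp
  star_inner x y := by rw [← unop_star, CStarModule.star_inner]
  inner_self_nonneg x := by
    have h : 0 ≤ unop (Inner.inner Bᵐᵒᵖ x.down x.down) := by
      rw [HilbertPair.inner_eq]
      exact add_nonneg (star_mul_self_nonneg _) (star_mul_self_nonneg _)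
    exact CStarAlgebra.nonneg_iff_eq_star_mul_self.1 h
  norm_sq_eq x := CStarModule.norm_sq_eq Bᵐᵒᵖ (x := x.down)
  left :=
    { toFun a :=
        { toFun x := ⟨HilbertPair.mk (φ₁ a * unop x.down.1) (φ₂ a * unop x.down.2)⟩
          map_add' x y := by
            refine ULift.down_injective (Prod.ext (unop_injective ?_) (unop_injective ?_))
            exacts [mul_add _ _ _, mul_add _ _ _]
          map_smul' c x := by
            refine ULift.down_injective (Prod.ext (unop_injective ?_) (unop_injective ?_))
            exacts [mul_smul_comm _ _ _, mul_smul_comm _ _ _] }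
      map_one' := by
        refine LinearMap.ext fun x ↦ ?_
        refine ULift.down_injective (Prod.ext (unop_injective ?_) (unop_injective ?_))
        · change φ₁ 1 * unop x.down.1 = unop x.down.1
          simp
        · change φ₂ 1 * unop x.down.2 = unop x.down.2
          simp
      map_mul' a b := by
        refine LinearMap.ext fun x ↦ ?_
        refine ULift.down_injective (Prod.ext (unop_injective ?_) (unop_injective ?_))
        · change φ₁ (a * b) * unop x.down.1 = φ₁ a * (φ₁ b * unop x.down.1)
          simp [mul_assoc]
        · change φ₂ (a * b) * unop x.down.2 = φ₂ a * (φ₂ b * unop x.down.2)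
          simp [mul_assoc]
      map_zero' := by
        refine LinearMap.ext fun x ↦ ?_
        refine ULift.down_injective (Prod.ext (unop_injective ?_) (unop_injective ?_))
        · change φ₁ 0 * unop x.down.1 = 0
          simp
        · change φ₂ 0 * unop x.down.2 = 0
          simp
      map_add' a b := by
        refine LinearMap.ext fun x ↦ ?_
        refine ULift.down_injective (Prod.ext (unop_injective ?_) (unop_injective ?_))
        · change φ₁ (a + b) * unop x.down.1 = φ₁ a * unop x.down.1 + φ₁ b * unop x.down.1
          simp [add_mul]
        · change φ₂ (a + b) * unop x.down.2 = φ₂ a * unop x.down.2 + φ₂ b * unop x.down.2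
          simp [add_mul]
      commutes' c := by
        refine LinearMap.ext fun x ↦ ?_
        refine ULift.down_injective (Prod.ext (unop_injective ?_) (unop_injective ?_))
        · change φ₁ (algebraMap ℂ A c) * unop x.down.1 = c • unop x.down.1
          simp [Algebra.algebraMap_eq_smul_one]
        · change φ₂ (algebraMap ℂ A c) * unop x.down.2 = c • unop x.down.2
          simp [Algebra.algebraMap_eq_smul_one] }
  inner_left a x y := by
    change star (φ₁ a * unop x.down.1) * unop y.down.1 + star (φ₂ a * unop x.down.2) *
      unop y.down.2 = star (unop x.down.1) * (φ₁ (star a) * unop y.down.1) +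
      star (unop x.down.2) * (φ₂ (star a) * unop y.down.2)
    simp [map_star, mul_assoc]

/-- The vector `(y, z)` of `HilbertBimodule.ofPair φ₁ φ₂`. -/
def HilbertBimodule.pair (φ₁ φ₂ : A →⋆ₐ[ℂ] B) (y z : B) : (ofPair φ₁ φ₂).carrier :=
  ULift.up.{max u v} (HilbertPair.mk y z)

theorem HilbertBimodule.inner_pair (φ₁ φ₂ : A →⋆ₐ[ℂ] B) (y z y' z' : B) :
    (ofPair φ₁ φ₂).inner (pair φ₁ φ₂ y z) (pair φ₁ φ₂ y' z') = star y * y' + star z * z' := rfl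

theorem HilbertBimodule.left_pair (φ₁ φ₂ : A →⋆ₐ[ℂ] B) (a : A) (y z : B) :
    (ofPair φ₁ φ₂).left a (pair φ₁ φ₂ y z) = pair φ₁ φ₂ (φ₁ a * y) (φ₂ a * z) := rfl

/-- Every contractive intertwiner of unital ⋆-homomorphisms `φ₁` and `φ₂` is an inner product of
vectors representing them. -/
theorem exists_inner_eq_of_intertwines {φ₁ φ₂ : A →⋆ₐ[ℂ] B} {b : B} (hb : ‖b‖ ≤ 1)
    (h : ∀ a, φ₁ a * b = b * φ₂ a) : ∃ E : HilbertBimodule A B, ∃ x₁ ∈ repSet E φ₁,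
      ∃ x₂ ∈ repSet E φ₂, E.inner x₁ x₂ = b := by
  have hcomm (a : A) : Commute (star b * b) (φ₂ a) := by
    have h' : star b * φ₁ a = φ₂ a * star b := by
      simpa [map_star] using congr(star $(h (star a)))
    rw [Commute, SemiconjBy, mul_assoc, ← h, ← mul_assoc, h', mul_assoc]
  have hnonneg : 0 ≤ 1 - star b * b := by
    rw [sub_nonneg, ← CStarAlgebra.norm_le_one_iff_of_nonneg _ (star_mul_self_nonneg b),
      CStarRing.norm_star_mul_self]
    exact mul_le_one₀ hb (norm_nonneg b) hb
  set s := CFC.sqrt (1 - star b * b)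
  have hss : s * s = 1 - star b * b := CFC.sqrt_mul_sqrt_self _ hnonneg
  have hstar : star s = s := (CFC.sqrt_nonneg _).isSelfAdjoint.star_eq
  -- The functional calculus preserves commutation, so the root commutes with the range of `φ₂` as
  -- `1 - b⋆b` does.
  have hscomm (a : A) : Commute s (φ₂ a) :=
    ((Commute.one_left _).sub_left (hcomm a)).cfcₙ_nnreal _
  -- `(b, s)` represents `φ₂` because `b⋆ φ₁(a) b + s φ₂(a) s = (b⋆b + s²) φ₂(a)`.
  refine ⟨.ofPair φ₁ φ₂, HilbertBimodule.pair φ₁ φ₂ 1 0, fun a ↦ ?_, HilbertBimodule.pair φ₁ φ₂ b s, fun a ↦ ?_, ?_⟩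
  · simp [HilbertBimodule.left_pair, HilbertBimodule.inner_pair]
  · rw [HilbertBimodule.left_pair, HilbertBimodule.inner_pair, hstar, h, ← (hscomm a).eq,
      ← mul_assoc, ← mul_assoc, hss, ← add_mul]
    simp
  · simp [HilbertBimodule.inner_pair]

end DirectSum

/-! ### The Bures distance as an infimum over intertwiners. -/

section Bures

variable {A : Type u} {B : Type v} [CStarAlgebra A] [CStarAlgebra B]

theorem bddBelow_buresOn (E : HilbertBimodule A B) (φ₁ φ₂ : A → B) :
    BddBelow {r | ∃ x₁ ∈ repSet E φ₁, ∃ x₂ ∈ repSet E φ₂, r = ‖x₁ - x₂‖} :=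
  ⟨0, by rintro _ ⟨x₁, -, x₂, -, rfl⟩; exact norm_nonneg _⟩

theorem buresOn_nonneg (E : HilbertBimodule A B) (φ₁ φ₂ : A → B) : 0 ≤ buresOn E φ₁ φ₂ :=
  Real.sInf_nonneg (by rintro _ ⟨x₁, -, x₂, -, rfl⟩; exact norm_nonneg _)

theorem buresDist_le_norm_sub {φ₁ φ₂ : A → B} {E : HilbertBimodule A B} {x₁ x₂ : E.carrier}
    (h₁ : x₁ ∈ repSet E φ₁) (h₂ : x₂ ∈ repSet E φ₂) : buresDist φ₁ φ₂ ≤ ‖x₁ - x₂‖ := by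
  have hbdd : BddBelow {r | ∃ E : HilbertBimodule A B, IsCommonRepModule E φ₁ φ₂ ∧
      r = buresOn E φ₁ φ₂} := ⟨0, by rintro _ ⟨E, -, rfl⟩; exact buresOn_nonneg E φ₁ φ₂⟩
  exact (csInf_le hbdd ⟨E, ⟨⟨x₁, h₁⟩, ⟨x₂, h₂⟩⟩, rfl⟩).trans
    (csInf_le (bddBelow_buresOn E φ₁ φ₂) ⟨x₁, h₁, x₂, h₂, rfl⟩)

/-- The Bures distance of two unital ⋆-homomorphisms into a unital C⋆-algebra in terms of their
contractive intertwiners. -/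
theorem buresDist_starAlgHom (φ₁ φ₂ : A →⋆ₐ[ℂ] B) :
    buresDist φ₁ φ₂ = √2 * sInf {r : ℝ | ∃ b : B, ‖b‖ ≤ 1 ∧ (∀ a : A, φ₁ a * b = b * φ₂ a) ∧
      r = √‖1 - (ℜ b : B)‖} := by
  set S := {r : ℝ | ∃ b : B, ‖b‖ ≤ 1 ∧ (∀ a : A, φ₁ a * b = b * φ₂ a) ∧ r = √‖1 - (ℜ b : B)‖}
  have hS : BddBelow S := ⟨0, by rintro _ ⟨b, -, -, rfl⟩; positivity⟩
  apply le_antisymm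
  · have h2 : (0 : ℝ) < √2 := by positivity
    rw [mul_comm, ← div_le_iff₀ h2]
    refine le_csInf ⟨_, 0, by simp, by simp, rfl⟩ ?_
    rintro _ ⟨b, hb, h, rfl⟩
    obtain ⟨E, x₁, h₁, x₂, h₂, rfl⟩ := exists_inner_eq_of_intertwines hb h
    rw [div_le_iff₀ h2, mul_comm, ← HilbertBimodule.norm_sub_eq
      (HilbertBimodule.inner_self_of_mem_repSet h₁) (HilbertBimodule.inner_self_of_mem_repSet h₂)]
    exact buresDist_le_norm_sub h₁ h₂
  · have hne : {r | ∃ E : HilbertBimodule A B, IsCommonRepModule E φ₁ φ₂ ∧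
        r = buresOn E φ₁ φ₂}.Nonempty := by
      obtain ⟨E, x₁, h₁, x₂, h₂, -⟩ := exists_inner_eq_of_intertwines (φ₁ := φ₁) (φ₂ := φ₂)
        (b := 0) (by simp) (by simp)
      exact ⟨_, E, ⟨⟨x₁, h₁⟩, ⟨x₂, h₂⟩⟩, rfl⟩
    refine le_csInf hne ?_
    rintro _ ⟨E, ⟨⟨x₁, h₁⟩, ⟨x₂, h₂⟩⟩, rfl⟩
    refine le_csInf ⟨_, x₁, h₁, x₂, h₂, rfl⟩ ?_
    rintro _ ⟨x₁, h₁, x₂, h₂, rfl⟩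
    have e₁ := HilbertBimodule.inner_self_of_mem_repSet h₁
    have e₂ := HilbertBimodule.inner_self_of_mem_repSet h₂
    rw [HilbertBimodule.norm_sub_eq e₁ e₂]
    gcongr
    exact csInf_le hS ⟨_, HilbertBimodule.norm_inner_le_one e₁ e₂,
      HilbertBimodule.intertwines_inner h₁ h₂, rfl⟩

/-- The Bures distance of two unitarily equivalent unital ⋆-homomorphisms in terms of the
commutant of the range of the first one. -/
theorem buresDist_starAlgHom_of_conj (φ₁ φ₂ : A →⋆ₐ[ℂ] B) (u : unitary B)
    (hu : ∀ a, φ₂ a = star (u : B) * φ₁ a * u) :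
    buresDist φ₁ φ₂ = √2 * sInf {r : ℝ | ∃ b' : B, b' ∈ Set.centralizer (Set.range φ₁) ∧
      ‖b'‖ ≤ 1 ∧ r = √‖1 - (ℜ (b' * (u : B)) : B)‖} := by
  have hu₁ : (u : B) * star (u : B) = 1 := Unitary.mul_star_self_of_mem u.2
  have hu₂ : star (u : B) * (u : B) = 1 := Unitary.star_mul_self_of_mem u.2
  rw [buresDist_starAlgHom]
  congr 2
  ext r
  constructor
  · rintro ⟨b, hb, h, rfl⟩
    refine ⟨b * star (u : B), ?_, ?_, ?_⟩
    · rintro _ ⟨a, rfl⟩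
      rw [← mul_assoc, h, hu, mul_assoc, mul_assoc _ (u : B), hu₁, mul_one, mul_assoc]
    · rwa [← Unitary.coe_star, CStarRing.norm_mul_coe_unitary]
    · rw [mul_assoc, hu₂, mul_one]
  · rintro ⟨b, h, hb, rfl⟩
    refine ⟨b * u, by rwa [CStarRing.norm_mul_coe_unitary], fun a ↦ ?_, rfl⟩
    rw [hu, ← mul_assoc, h _ ⟨a, rfl⟩, ← mul_assoc, ← mul_assoc, mul_assoc b (u : B), hu₁, mul_one]

end Bures
theorem corollary2p9
    {A : Type u} [CStarAlgebra A]
    {G : Type v} [NormedAddCommGroup G] [InnerProductSpace ℂ G] [CompleteSpace G]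
    (B : VonNeumannAlgebra G) :
    -- (i)
    (∀ φ₁ φ₂ : A →⋆ₐ[ℂ] B,
      buresDist φ₁ φ₂ =
        √2 * sInf {r : ℝ | ∃ b : B, ‖b‖ ≤ 1 ∧ (∀ a : A, φ₁ a * b = b * φ₂ a) ∧
          r = √‖1 - (ℜ b : B)‖}) ∧
    -- (ii)
    (∀ (φ₁ φ₂ : B →⋆ₐ[ℂ] B) (u : unitary B), (∀ a : B, φ₂ a = star (u : B) * φ₁ a * u) →
      buresDist φ₁ φ₂ =
        √2 * sInf {r : ℝ | ∃ b' : B, b' ∈ Set.centralizer (Set.range φ₁) ∧ ‖b'‖ ≤ 1 ∧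
          r = √‖1 - (ℜ (b' * (u : B)) : B)‖}) ∧
    -- (iii)
    (∀ (n : ℕ) (u : Matrix.unitaryGroup (Fin n) ℂ)
        (φ : Matrix (Fin n) (Fin n) ℂ →⋆ₐ[ℂ] Matrix (Fin n) (Fin n) ℂ),
      (∀ a, φ a = star (u : Matrix (Fin n) (Fin n) ℂ) * a * u) →
      buresDist (StarAlgHom.id ℂ (Matrix (Fin n) (Fin n) ℂ)) φ =
        √2 * sInf {r : ℝ | ∃ c : ℂ, ‖c‖ ≤ 1 ∧
          r = √‖1 - (ℜ (c • (u : Matrix (Fin n) (Fin n) ℂ)) : Matrix (Fin n) (Fin n) ℂ)‖}) := by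
  refine ⟨buresDist_starAlgHom, buresDist_starAlgHom_of_conj, fun n u φ hφ ↦ ?_⟩
  rw [buresDist_starAlgHom_of_conj (StarAlgHom.id ℂ (Matrix (Fin n) (Fin n) ℂ)) φ u hφ]
  congr 2
  ext r
  constructor
  · rintro ⟨b, hb, hn, rfl⟩
    have hb' : b ∈ Set.center (Matrix (Fin n) (Fin n) ℂ) := by
      rw [← Set.centralizer_univ]
      exact fun a _ ↦ hb a ⟨a, rfl⟩
    rw [Matrix.center_eq_range] at hb'
    obtain ⟨c, rfl⟩ := hb'
    rw [Matrix.scalar_apply, ← Matrix.smul_one_eq_diagonal] at hn ⊢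
    -- For `n = 0` the identity matrix has norm `0`, so `hn` does not bound `c`; the scalar `0`
    -- serves instead.
    rcases isEmpty_or_nonempty (Fin n) with _ | _
    · exact ⟨0, by simp, by congr 3; exact Subsingleton.elim _ _⟩
    · refine ⟨c, ?_, by rw [smul_mul_assoc, one_mul]⟩
      rwa [norm_smul, CStarRing.norm_one, mul_one] at hn
  · rintro ⟨c, hc, rfl⟩
    refine ⟨c • 1, ?_, ?_, by rw [smul_mul_assoc, one_mul]⟩
    · rintro a -
      simp
    · rcases isEmpty_or_nonempty (Fin n) with _ | _
      · rw [Subsingleton.elim (c • (1 : Matrix (Fin n) (Fin n) ℂ)) 0, norm_zero]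
        exact zero_le_one
      · rwa [norm_smul, CStarRing.norm_one, mul_one]
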